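/- All graphs are finite, simple, undirected and connected. For a graph $G$ of order $n$, let $\delta(G)$ be its minimum degree, let $\lambda_1(G)$ be the largest eigenvalue of its adjacency matrix, and let its connectivity $\kappa(G)$ be the least size of a set $S$ of vertices such that $G-S$ is disconnected or has at most one vertex. $G$ is $k$-connected if $\kappa(G)\ge k$, where $k\geq 0$ is an integer, and $G$ is Hamiltonian-connected if every two distinct vertices of $G$ are joined by a path passing through all vertices of $G$. Let $K_{a,b}$ denote the complete bipartite graph with parts of sizes $a$ and $b$. **Theorem.** Let $G$ be a $k$-connected graph of order $n\ge 3$ with minimum degree $\delta=\delta(G)$. If $$\lambda_1(G)\le \delta\sqrt{\frac{k}{n-k}},$$ then $G$ is Hamiltonian-connected if and only if $G$ is not isomorphic to $K_{k,k}$. -/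

import Mathlib

namespace SimpleGraph

/-- The connectivity `κ(G)` of a finite graph: the least size of a set `S` of vertices such that
`G - S` is disconnected or has at most one vertex. So `κ(Kₙ) = n - 1`, and `κ(G) = 0` if `G` is
disconnected. -/
noncomputable def vertexConnectivity {V : Type*} [Fintype V] (G : SimpleGraph V) : ℕ :=
  sInf {c : ℕ | ∃ S : Finset V, S.card = c ∧
    (¬ (G.induce {v : V | v ∉ S}).Preconnected ∨ Fintype.card V ≤ S.card + 1)}

/-- `G` is `k`-connected if `κ(G) ≥ k`. -/
def IsKConnected {V : Type*} [Fintype V] (G : SimpleGraph V) (k : ℕ) : Prop :=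
  k ≤ G.vertexConnectivity

/-- `G` is Hamiltonian-connected if every two vertices are joined by a Hamiltonian path. -/
def IsHamiltonianConnected {V : Type*} [DecidableEq V] (G : SimpleGraph V) : Prop :=
  ∀ u v : V, u ≠ v → ∃ p : G.Walk u v, p.IsHamiltonian

theorem isHermitian_adjMatrix_real {V : Type*} (G : SimpleGraph V) [DecidableRel G.Adj] :
    (G.adjMatrix ℝ).IsHermitian := by
  rw [Matrix.IsHermitian, Matrix.conjTranspose_eq_transpose_of_trivial]
  exact G.isSymm_adjMatrix

/-- `λ₁(G)`, the largest eigenvalue of the adjacency matrix of `G`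
(a maximum over a finite family, which is nonempty when `V` is). -/
noncomputable def adjSpectralRadius {V : Type*} [Fintype V] [DecidableEq V]
    (G : SimpleGraph V) [DecidableRel G.Adj] : ℝ :=
  ⨆ v : V, G.isHermitian_adjMatrix_real.eigenvalues v

end SimpleGraph

/-! The average degree is at most `λ₁`, so `δ ≤ λ₁ ≤ δ√(k/(n-k))` and hence `n ≤ 2k`. If `G` is not
Hamiltonian-connected, Chvátal–Erdős (`IsKConnected.isHamiltonianConnected_of_isIndepSet`) yields an
independent set `I` with at least `k` vertices. Each vertex of `I` has at least `δ ≥ k` neighbours,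
all outside `I`, so `I` and its complement both have size `k` and are completely joined, and `δ =
k`. Now the hypothesis reads `λ₁ ≤ δ`, which makes `G` regular; the complement of `I` has no degree
left for inner edges, and `G` is `K_{k,k}`. The converse is a parity argument on the bipartition. -/

namespace SimpleGraph

/-! ### Lengthening paths by detours -/

section LongestPath

variable {V : Type*} {G : SimpleGraph V}

/-- `l` lists the vertices of a path of `G` from `u` to `v`. -/
structure IsPathList (G : SimpleGraph V) (u v : V) (l : List V) : Prop where
  isChain : l.IsChain G.Adj
  nodup : l.Nodup
  head : l.head? = some u
  getLast : l.getLast? = some v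

/-- The vertices reachable from `w` by walks avoiding `l`. -/
def avoiding (G : SimpleGraph V) (l : List V) (w : V) : Set V :=
  {h | ∃ p : G.Walk w h, ∀ x ∈ p.support, x ∉ l}

theorem Walk.IsPath.isPathList {u v : V} {p : G.Walk u v} (hp : p.IsPath) :
    G.IsPathList u v p.support where
  isChain := p.isChain_adj_support
  nodup := hp.support_nodup
  head := by cases p <;> simp
  getLast := by rw [List.getLast?_eq_some_getLast p.support_ne_nil, p.getLast_support]

theorem IsPathList.exists_isPath {u v : V} {l : List V} (hl : G.IsPathList u v l) :
    ∃ p : G.Walk u v, p.IsPath ∧ p.support = l := by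
  have hne : l ≠ [] := by rintro rfl; simpa using hl.head
  have h1 : l.head hne = u := by simpa [List.head?_eq_some_head hne] using hl.head
  have h2 : l.getLast hne = v := by simpa [List.getLast?_eq_some_getLast hne] using hl.getLast
  subst h1 h2
  have hs : (Walk.ofSupport l hne hl.isChain).support = l := by simp
  exact ⟨Walk.ofSupport l hne hl.isChain, Walk.IsPath.mk' (by rw [hs]; exact hl.nodup), hs⟩

theorem exists_isPathList_of_mem_avoiding {l : List V} {w h h' : V}
    (hh : h ∈ G.avoiding l w) (hh' : h' ∈ G.avoiding l w) :
    ∃ q, G.IsPathList h h' q ∧ ∀ x ∈ q, x ∉ l := by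
  classical
  obtain ⟨p, hp⟩ := hh
  obtain ⟨p', hp'⟩ := hh'
  refine ⟨_, ((p.reverse.append p').bypass_isPath).isPathList, fun x hx => ?_⟩
  have := Walk.support_bypass_subset_support _ hx
  rw [Walk.mem_support_append_iff, Walk.support_reverse, List.mem_reverse] at this
  exact this.elim (hp x) (hp' x)

theorem mem_avoiding_of_adj {l : List V} {w h z : V} (hh : h ∈ G.avoiding l w)
    (hz : G.Adj h z) (hzl : z ∉ l) : z ∈ G.avoiding l w := by
  obtain ⟨p, hp⟩ := hh
  refine ⟨p.concat hz, fun x hx => ?_⟩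
  rw [Walk.support_concat, List.mem_append, List.mem_singleton] at hx
  rcases hx with hx | rfl
  exacts [hp x hx, hzl]

/-- On a longest path this forbids two consecutive vertices with neighbours in the same component
off the path. -/
theorem IsPathList.insert {u v x y h h' : V} {A B q : List V} (hl : G.IsPathList u v (A ++ B))
    (hx : A.getLast? = some x) (hy : B.head? = some y) (hq : G.IsPathList h h' q)
    (hdisj : ∀ z ∈ q, z ∉ A ++ B) (hxh : G.Adj x h) (hhy : G.Adj h' y) :
    G.IsPathList u v (A ++ (q ++ B)) where
  isChain := by
    have := hl.isChain
    rw [List.isChain_append] at this ⊢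
    rw [List.isChain_append]
    simp [this.1, this.2.1, hq.isChain, hx, hq.getLast, hq.head, hy, hxh, hhy]
  nodup := by
    have := hl.nodup
    have := hq.nodup
    grind
  head := by
    have := hl.head
    cases A <;> simp_all
  getLast := by
    have := hl.getLast
    cases B <;> simp_all [List.getLast?_cons]

/-- The new path leaves `x` through `q` to `y`, runs `B` backwards to `x'` and jumps to `y'`. On a
longest path this makes the successors of attachment vertices pairwise nonadjacent. -/
theorem IsPathList.reroute {u v x x' y y' h h' : V} {A B C q : List V}
    (hl : G.IsPathList u v (A ++ (B ++ C)))
    (hx : A.getLast? = some x) (hx' : B.head? = some x') (hy : B.getLast? = some y)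
    (hy' : C.head? = some y') (hq : G.IsPathList h h' q)
    (hdisj : ∀ z ∈ q, z ∉ A ++ (B ++ C)) (hxh : G.Adj x h) (hhy : G.Adj h' y)
    (hadj : G.Adj x' y') :
    G.IsPathList u v (A ++ (q ++ (B.reverse ++ C))) where
  isChain := by
    have := hl.isChain
    simp only [List.isChain_append] at this ⊢
    have hr : B.reverse.IsChain G.Adj := by
      rw [List.isChain_reverse]
      simpa only [G.adj_comm] using this.2.1.1
    simp [this.1, this.2.1.2.1, hr, hq.isChain, hx, hq.getLast, hq.head, hy, hx', hy', hxh, hhy,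
      hadj]
  nodup := by
    have := hl.nodup
    have := hq.nodup
    grind
  head := by
    have := hl.head
    cases A <;> simp_all
  getLast := by
    have := hl.getLast
    cases C <;> simp_all [List.getLast?_cons]

theorem IsPathList.length_pos {u v : V} {l : List V} (hl : G.IsPathList u v l) :
    0 < l.length := by
  have := hl.head
  cases l <;> simp_all

end LongestPath

/-! ### Separating sets and degrees -/

section Connectivity

variable {V : Type*} [Fintype V] {G : SimpleGraph V} {k : ℕ}

theorem IsKConnected.preconnected_induce (hk : G.IsKConnected k) {S : Finset V}
    (hS : S.card < k) : (G.induce {v : V | v ∉ S}).Preconnected := by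
  by_contra h
  exact absurd (Nat.sInf_le (s := {c : ℕ | ∃ S : Finset V, S.card = c ∧
    (¬ (G.induce {v : V | v ∉ S}).Preconnected ∨ Fintype.card V ≤ S.card + 1)})
    ⟨S, rfl, Or.inl h⟩) (not_le.2 (hS.trans_le hk))

theorem IsKConnected.lt_card [Nonempty V] (hk : G.IsKConnected k) : k < Fintype.card V := by
  classical
  obtain ⟨v⟩ := ‹Nonempty V›
  have hc : 0 < Fintype.card V := Fintype.card_pos_iff.2 ⟨v⟩
  have he : (Finset.univ.erase v).card = Fintype.card V - 1 := by
    rw [Finset.card_erase_of_mem (Finset.mem_univ v), Finset.card_univ]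
  have : k ≤ Fintype.card V - 1 := hk.trans (Nat.sInf_le ⟨_, he, Or.inr (by omega)⟩)
  omega

/-- A set of fewer than `k` vertices that contains all outer neighbours of `H` separates no vertex
from `H`. -/
theorem IsKConnected.le_card_of_separates (hk : G.IsKConnected k) {S : Finset V} {H : Set V}
    (hclosed : ∀ h ∈ H, ∀ z, G.Adj h z → z ∉ S → z ∈ H) {w p : V} (hw : w ∈ H) (hwS : w ∉ S)
    (hp : p ∉ H) (hpS : p ∉ S) : k ≤ S.card := by
  by_contra! hlt
  obtain ⟨q⟩ := hk.preconnected_induce hlt ⟨w, hwS⟩ ⟨p, hpS⟩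
  have key : ∀ (a b : {v : V | v ∉ S}) (_ : (G.induce {v : V | v ∉ S}).Walk a b),
      a.1 ∈ H → b.1 ∈ H := by
    intro a b r
    induction r with
    | nil => exact id
    | @cons a c b hac _ ih => exact fun ha => ih (hclosed _ ha _ hac c.2)
  exact hp (key _ _ q hw)

theorem IsKConnected.le_degree [DecidableRel G.Adj] [Nonempty V]
    (hk : G.IsKConnected k) (v : V) : k ≤ G.degree v := by
  classical
  by_contra! hlt
  have hlt' := hk.lt_card
  have hc : (insert v (G.neighborFinset v)).card < Fintype.card V := by
    have := Finset.card_insert_le v (G.neighborFinset v)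
    rw [card_neighborFinset_eq_degree] at this
    omega
  obtain ⟨z, hz⟩ : ∃ z, z ∉ insert v (G.neighborFinset v) := by
    by_contra! h
    rw [Finset.eq_univ_iff_forall.2 h, Finset.card_univ] at hc
    exact lt_irrefl _ hc
  rw [Finset.mem_insert, not_or] at hz
  have := hk.le_card_of_separates (S := G.neighborFinset v) (H := {v}) (w := v) (p := z)
    (by
      rintro h rfl z hz hz'
      exact absurd ((G.mem_neighborFinset _ _).2 hz) hz') rfl (by simp) hz.1 hz.2
  rw [card_neighborFinset_eq_degree] at this
  omega

end Connectivity

/-! ### The Chvátal–Erdős argument -/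

section ChvatalErdos

variable {V : Type*} [Fintype V] {G : SimpleGraph V} {k : ℕ}

/-- If a longest path between two distinct vertices of a `k`-connected graph misses a vertex, then
there is an independent set of size at least `k`. -/
theorem IsKConnected.exists_isIndepSet_of_longest (hk : G.IsKConnected k)
    {u v w : V} (huv : u ≠ v) {l : List V} (hl : G.IsPathList u v l) (hw : w ∉ l)
    (hmax : ∀ l', G.IsPathList u v l' → l'.length ≤ l.length) :
    ∃ I : Finset V, k ≤ I.card ∧ G.IsIndepSet I := by
  classical
  set H := G.avoiding l w with hH
  have hwH : w ∈ H := ⟨Walk.nil, by simpa using hw⟩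
  have hHl : ∀ h ∈ H, h ∉ l := fun h ⟨p, hp⟩ => hp h p.end_mem_support
  -- The default `u` is harmless: `f` is only used at indices below `l.length`.
  set f : ℕ → V := fun i => l.getD i u with hf
  have hfl : ∀ i < l.length, l[i]? = some (f i) := fun i hi => by simp [hf, hi]
  have hfmem : ∀ i < l.length, f i ∈ l := fun i hi => List.mem_of_getElem? (hfl i hi)
  have hfinj : ∀ i < l.length, ∀ j < l.length, f i = f j → i = j := fun i hi j hj h => by
    have := (hfl i hi).trans (h ▸ (hfl j hj).symm)
    exact (List.getElem?_inj hi hl.nodup).1 this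
  have hlen : 2 ≤ l.length := by
    have h1 := hl.head
    have h2 := hl.getLast
    match l with
    | [] => simp at h1
    | [a] => simp at h1 h2; exact absurd (h1.symm.trans h2) huv
    | a :: b :: t => simp
  set P : ℕ → Prop := fun i => ∃ h ∈ H, G.Adj h (f i) with hP
  have last : ∀ i < l.length, (l.take (i + 1)).getLast? = some (f i) := fun i hi => by
    simp [List.getLast?_take, hfl i hi]
  have hext : ∀ i, i + 1 < l.length → P i → ¬ P (i + 1) := by
    rintro i hi ⟨h, hh, hadj⟩ ⟨h', hh', hadj'⟩
    obtain ⟨q, hq, hql⟩ := exists_isPathList_of_mem_avoiding hh hh'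
    have hl' : G.IsPathList u v (l.take (i + 1) ++ l.drop (i + 1)) := by
      rwa [List.take_append_drop]
    have := hmax _ (hl'.insert (x := f i) (y := f (i + 1)) (last i (by omega))
      (by rw [List.head?_drop, hfl _ hi]) hq (by rwa [List.take_append_drop]) hadj.symm hadj')
    have hpos := hq.length_pos
    simp only [List.length_append, List.length_take, List.length_drop] at this
    omega
  have hrot : ∀ i j, i < j → j + 1 < l.length → P i → P j → ¬ G.Adj (f (i + 1)) (f (j + 1)) := by
    rintro i j hij hj ⟨h, hh, hadj⟩ ⟨h', hh', hadj'⟩ hadj''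
    obtain ⟨q, hq, hql⟩ := exists_isPathList_of_mem_avoiding hh hh'
    have hdec : l.take (i + 1) ++ ((l.drop (i + 1)).take (j - i) ++ l.drop (j + 1)) = l := by
      have : l.drop (j + 1) = (l.drop (i + 1)).drop (j - i) := by
        rw [List.drop_drop]; congr 1; omega
      rw [this, List.take_append_drop, List.take_append_drop]
    have hB1 : ((l.drop (i + 1)).take (j - i)).head? = some (f (i + 1)) := by
      rw [List.head?_take, if_neg (by omega), List.head?_drop, hfl _ (by omega)]
    have hB2 : ((l.drop (i + 1)).take (j - i)).getLast? = some (f j) := by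
      rw [List.getLast?_take, if_neg (by omega), List.getElem?_drop,
        show i + 1 + (j - i - 1) = j by omega, hfl _ (by omega)]
      rfl
    have := hmax _ ((hdec.symm ▸ hl : G.IsPathList u v _).reroute (x := f i) (last i (by omega))
      hB1 hB2 (by rw [List.head?_drop, hfl _ hj]) hq (by rwa [hdec]) hadj.symm hadj' hadj'')
    have hpos := hq.length_pos
    simp only [List.length_append, List.length_take, List.length_drop, List.length_reverse] at this
    omega
  set N := (Finset.range l.length).filter P with hN
  -- The attachment vertices separate `w` from any other path vertex; one exists because positions 0
  -- and 1 are not both attached.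
  have hNk : k ≤ (N.image f).card := by
    obtain ⟨i, hi, hPi⟩ : ∃ i < l.length, ¬ P i := by
      by_cases h0 : P 0
      · exact ⟨1, by omega, hext 0 (by omega) h0⟩
      · exact ⟨0, by omega, h0⟩
    have hNl : ∀ x, x ∈ N.image f ↔ x ∈ l ∧ ∃ h ∈ H, G.Adj h x := by
      intro x
      simp only [hN, Finset.mem_image, Finset.mem_filter, Finset.mem_range, hP]
      constructor
      · rintro ⟨j, ⟨hj, hj'⟩, rfl⟩
        exact ⟨hfmem j hj, hj'⟩
      · rintro ⟨hx, hx'⟩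
        obtain ⟨j, hj⟩ := List.mem_iff_getElem?.1 hx
        have hjl : j < l.length := by
          by_contra hcon
          simp [List.getElem?_eq_none (not_lt.1 hcon)] at hj
        have : f j = x := by rw [hfl j hjl] at hj; exact Option.some.inj hj
        exact ⟨j, ⟨hjl, this ▸ hx'⟩, this⟩
    refine hk.le_card_of_separates (H := H) (w := w) (p := f i) ?_ hwH ?_ ?_ ?_
    · intro h hh z hz hzN
      exact mem_avoiding_of_adj hh hz fun hzl => hzN ((hNl z).2 ⟨hzl, h, hh, hz⟩)
    · exact fun h => hw ((hNl w).1 h).1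
    · exact fun h => hHl _ h (hfmem i hi)
    · exact fun h => hPi ((hNl _).1 h).2
  -- The last position has no successor. Dropping it loses at most one element, which `w` makes up
  -- for in the independent set.
  set T := (Finset.range (l.length - 1)).filter P with hT
  have hTmem : ∀ i ∈ T, i + 1 < l.length ∧ P i := fun i hi => by
    rw [hT, Finset.mem_filter, Finset.mem_range] at hi
    exact ⟨by omega, hi.2⟩
  have hNT : N.card ≤ T.card + 1 := by
    refine le_trans (Finset.card_le_card (t := insert (l.length - 1) T) fun i hi => ?_)
      (Finset.card_insert_le _ _)
    rw [hN, Finset.mem_filter, Finset.mem_range] at hi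
    rw [hT, Finset.mem_insert, Finset.mem_filter, Finset.mem_range]
    by_cases h : i = l.length - 1
    · exact Or.inl h
    · exact Or.inr ⟨by omega, hi.2⟩
  refine ⟨insert w (T.image fun i => f (i + 1)), ?_, ?_⟩
  · rw [Finset.card_insert_of_notMem, Finset.card_image_of_injOn]
    · exact hNk.trans (Finset.card_image_le.trans hNT)
    · intro i hi j hj hij
      have := hfinj _ (hTmem i hi).1 _ (hTmem j hj).1 hij
      omega
    · rw [Finset.mem_image]
      rintro ⟨i, hi, rfl⟩
      exact hw (hfmem _ (hTmem i hi).1)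
  · have hwT : ∀ i ∈ T, ¬ G.Adj w (f (i + 1)) := fun i hi hadj =>
      hext i (hTmem i hi).1 (hTmem i hi).2 ⟨w, hwH, hadj⟩
    intro a ha b hb hab hadj
    rw [Finset.mem_coe, Finset.mem_insert, Finset.mem_image] at ha hb
    rcases ha with rfl | ⟨i, hi, rfl⟩ <;> rcases hb with rfl | ⟨j, hj, rfl⟩
    · exact hab rfl
    · exact hwT j hj hadj
    · exact hwT i hi hadj.symm
    · rcases lt_trichotomy i j with h | rfl | h
      · exact hrot i j h (hTmem j hj).1 (hTmem i hi).2 (hTmem j hj).2 hadj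
      · exact hab rfl
      · exact hrot j i h (hTmem i hi).1 (hTmem j hj).2 (hTmem i hi).2 hadj.symm

/-- The **Chvátal–Erdős theorem** on Hamiltonian-connected graphs. -/
theorem IsKConnected.isHamiltonianConnected_of_isIndepSet [DecidableEq V] (hconn : G.Connected)
    (hk : G.IsKConnected k) (hindep : ∀ I : Finset V, G.IsIndepSet I → I.card < k) :
    G.IsHamiltonianConnected := by
  intro u v huv
  obtain ⟨p₀, hp₀⟩ := (hconn.preconnected u v).exists_isPath
  obtain ⟨m, ⟨⟨l, hl, rfl⟩, -⟩, hmax⟩ := (Set.finite_le_nat (Fintype.card V)).inter_of_right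
    {m | ∃ l, G.IsPathList u v l ∧ l.length = m} |>.exists_maximal
    ⟨_, ⟨_, hp₀.isPathList, rfl⟩, hp₀.isPathList.nodup.length_le_card⟩
  have hmax' : ∀ l', G.IsPathList u v l' → l'.length ≤ l.length := fun l' hl' => by
    by_contra! h
    exact absurd (hmax ⟨⟨l', hl', rfl⟩, hl'.nodup.length_le_card⟩ h.le) (not_le.2 h)
  obtain ⟨p, hp, hpl⟩ := hl.exists_isPath
  refine ⟨p, hp.isHamiltonian_of_mem fun w => ?_⟩
  rw [hpl]
  by_contra hw
  obtain ⟨I, hI, hI'⟩ := hk.exists_isIndepSet_of_longest huv hl hw hmax'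
  exact absurd (hindep I hI') (not_lt.2 hI)

end ChvatalErdos

/-! ### Average degree and spectral radius -/

section SpectralRadius

variable {V : Type*} [Fintype V] [DecidableEq V] (G : SimpleGraph V) [DecidableRel G.Adj]

theorem posSemidef_adjSpectralRadius_sub :
    (algebraMap ℝ (Matrix V V ℝ) G.adjSpectralRadius - G.adjMatrix ℝ).PosSemidef := by
  have hA := G.isHermitian_adjMatrix_real
  have hB : (algebraMap ℝ (Matrix V V ℝ) G.adjSpectralRadius - G.adjMatrix ℝ).IsHermitian := by
    refine Matrix.IsHermitian.sub ?_ hA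
    rw [Matrix.algebraMap_eq_diagonal]
    exact Matrix.isHermitian_diagonal _
  rw [hB.posSemidef_iff_eigenvalues_nonneg]
  intro i
  have := hB.eigenvalues_mem_spectrum_real i
  rw [← spectrum.singleton_sub_eq, hA.spectrum_real_eq_range_eigenvalues,
    Set.singleton_sub, Set.mem_image] at this
  obtain ⟨_, ⟨j, rfl⟩, hj⟩ := this
  rw [← hj, Pi.zero_apply, sub_nonneg]
  exact le_ciSup (f := hA.eigenvalues) (Set.finite_range _).bddAbove j

/-- The average degree is at most the spectral radius. -/
theorem sum_degree_le_card_mul_adjSpectralRadius :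
    ∑ v, (G.degree v : ℝ) ≤ Fintype.card V * G.adjSpectralRadius := by
  -- Rayleigh quotient of the all-ones vector.
  have := G.posSemidef_adjSpectralRadius_sub.dotProduct_mulVec_nonneg (fun _ => (1 : ℝ))
  have h1 : (G.adjMatrix ℝ).mulVec (fun _ => (1 : ℝ)) = fun v => (G.degree v : ℝ) := by
    ext v
    simp [adjMatrix_mulVec_apply]
  rw [Matrix.sub_mulVec, h1, Algebra.algebraMap_eq_smul_one, Matrix.smul_mulVec,
    Matrix.one_mulVec] at this
  simp [dotProduct, Finset.sum_sub_distrib] at this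
  linarith

end SpectralRadius

/-! ### Balanced complete bipartite graphs -/

section CompleteBipartite

/-- A Hamiltonian-connected graph with at least three vertices is not a balanced complete
bipartite graph. -/
theorem IsHamiltonianConnected.not_iso_completeBipartiteGraph {V : Type*} [Fintype V]
    [DecidableEq V] {G : SimpleGraph V} (hG : G.IsHamiltonianConnected) {k : ℕ}
    (hcard : 3 ≤ Fintype.card V) :
    ¬ Nonempty (G ≃g completeBipartiteGraph (Fin k) (Fin k)) := by
  rintro ⟨e⟩
  have hc : Fintype.card V = k + k := by
    rw [Fintype.card_congr e.toEquiv]; simp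
  have h2 : 2 ≤ k := by omega
  obtain ⟨p, hp⟩ := hG (e.symm (Sum.inl ⟨0, by omega⟩)) (e.symm (Sum.inl ⟨1, by omega⟩))
    (by simp)
  let c : G.Coloring Bool := Coloring.mk (fun v => (e v).isLeft) fun {a b} hab => by
    have := e.map_adj_iff.2 hab
    rcases ha : e a with x | x <;> rcases hb : e b with y | y <;> simp_all
  -- The ends lie on the same side, so the length is even, yet a Hamiltonian path has length `2k -
  -- 1`.
  have := (c.even_length_iff_congr p).2 (by
    change (e _).isLeft = true ↔ (e _).isLeft = true
    simp)
  rw [hp.length_eq, hc] at this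
  rw [Nat.even_iff] at this
  omega

/-- A graph with two independent sides of size `k`, completely joined, is `K_{k,k}`. -/
theorem nonempty_iso_completeBipartiteGraph {V : Type*} [Fintype V] [DecidableEq V]
    {G : SimpleGraph V} {k : ℕ} {I : Finset V} (hI : I.card = k) (hI' : Iᶜ.card = k)
    (hadj : ∀ a b, G.Adj a b ↔ ¬ (a ∈ I ↔ b ∈ I)) :
    Nonempty (G ≃g completeBipartiteGraph (Fin k) (Fin k)) := by
  let e₁ : {v // v ∈ I} ≃ Fin k := I.equivFinOfCardEq hI
  let e₂ : {v // v ∉ I} ≃ Fin k :=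
    (Equiv.subtypeEquivRight fun v => by simp).trans (Iᶜ.equivFinOfCardEq hI')
  let e : V ≃ Fin k ⊕ Fin k := (Equiv.sumCompl (· ∈ I)).symm.trans (Equiv.sumCongr e₁ e₂)
  refine ⟨⟨e, fun {a b} => ?_⟩⟩
  rw [hadj]
  by_cases ha : a ∈ I <;> by_cases hb : b ∈ I <;>
    simp [e, ha, hb, Equiv.sumCompl_symm_apply_of_pos, Equiv.sumCompl_symm_apply_of_neg]

end CompleteBipartite

end SimpleGraph

theorem theorem1p2 {V : Type*} [Fintype V] [DecidableEq V] (G : SimpleGraph V)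
    [DecidableRel G.Adj] (hconn : G.Connected) (n k : ℕ) (hcard : Fintype.card V = n)
    (hn : 3 ≤ n) (hk : G.IsKConnected k)
    (hspec : G.adjSpectralRadius ≤ (G.minDegree : ℝ) * Real.sqrt ((k : ℝ) / ((n : ℝ) - (k : ℝ)))) :
    G.IsHamiltonianConnected ↔ ¬ Nonempty (G ≃g completeBipartiteGraph (Fin k) (Fin k)) := by
  
  classical
  subst hcard
  have : Nonempty V := hconn.nonempty
  refine ⟨fun h => h.not_iso_completeBipartiteGraph hn, fun hiso => ?_⟩
  by_contra hnot
  have hkn := hk.lt_card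
  have hmin : ∀ v, G.minDegree ≤ G.degree v := G.minDegree_le_degree
  have hkmin : k ≤ G.minDegree := by
    obtain ⟨v, hv⟩ := G.exists_minimal_degree_vertex
    exact hv ▸ hk.le_degree v
  obtain ⟨I, hI, hkI⟩ : ∃ I : Finset V, G.IsIndepSet I ∧ k ≤ I.card := by
    by_contra! h
    exact hnot (hk.isHamiltonianConnected_of_isIndepSet hconn h)
  have hδ : 0 < G.minDegree := by
    have : Nontrivial V := Fintype.one_lt_card_iff_nontrivial.1 (by omega)
    obtain ⟨v, hv⟩ := G.exists_minimal_degree_vertex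
    exact hv ▸ hconn.preconnected.degree_pos_of_nontrivial v
  have hδ' : (0 : ℝ) < G.minDegree := by exact_mod_cast hδ
  have hc : (0 : ℝ) < Fintype.card V := by exact_mod_cast Fintype.card_pos
  have hsum := G.sum_degree_le_card_mul_adjSpectralRadius
  have hlow : (Fintype.card V : ℝ) * G.minDegree ≤ ∑ v, (G.degree v : ℝ) := by
    rw [← nsmul_eq_mul, ← Finset.card_univ]
    exact Finset.card_nsmul_le_sum _ _ _ fun v _ => by exact_mod_cast hmin v
  have hnk : (0 : ℝ) < (Fintype.card V : ℝ) - k := by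
    rw [sub_pos]; exact_mod_cast hkn
  have hle : Fintype.card V ≤ 2 * k := by
    have h1 : (G.minDegree : ℝ) * 1 ≤ G.minDegree * √((k : ℝ) / (Fintype.card V - k)) := by
      rw [mul_one]
      exact (le_of_mul_le_mul_left (hlow.trans hsum) hc).trans hspec
    have h2 := le_of_mul_le_mul_left h1 hδ'
    rw [Real.one_le_sqrt, one_le_div hnk] at h2
    have : (Fintype.card V : ℝ) ≤ 2 * k := by linarith
    exact_mod_cast this
  have hIne : I.Nonempty := Finset.card_pos.1 (by omega)
  have hcompl := I.card_add_card_compl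
  have hnbr : ∀ a ∈ I, G.neighborFinset a ⊆ Iᶜ := fun a ha b hb => by
    rw [Finset.mem_compl]
    rw [SimpleGraph.mem_neighborFinset] at hb
    exact fun hbI => hI ha hbI hb.ne hb
  have hdegI : ∀ a ∈ I, k ≤ Iᶜ.card := fun a ha => by
    have := Finset.card_le_card (hnbr a ha)
    rw [SimpleGraph.card_neighborFinset_eq_degree] at this
    exact (hkmin.trans (hmin a)).trans this
  obtain ⟨a₀, ha₀⟩ := hIne
  have hIc : Iᶜ.card = k := by have := hdegI a₀ ha₀; omega
  have hIk : I.card = k := by have := hdegI a₀ ha₀; omega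
  have hfull : ∀ a ∈ I, G.neighborFinset a = Iᶜ := fun a ha =>
    Finset.eq_of_subset_of_card_le (hnbr a ha) (by
      rw [hIc, SimpleGraph.card_neighborFinset_eq_degree]; exact hkmin.trans (hmin a))
  have hmink : G.minDegree = k := by
    refine le_antisymm ((hmin a₀).trans ?_) hkmin
    rw [← SimpleGraph.card_neighborFinset_eq_degree, hfull a₀ ha₀, hIc]
  have hreg : ∀ v, G.degree v = k := by
    have hdiv : (k : ℝ) / (Fintype.card V - k) = 1 := by
      have : Fintype.card V = k + k := by omega
      rw [div_eq_one_iff_eq hnk.ne', this]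
      push_cast; ring
    rw [hdiv, Real.sqrt_one, mul_one] at hspec
    have hle' : ∑ v, (G.degree v : ℝ) ≤ ∑ v : V, (G.minDegree : ℝ) := by
      rw [Finset.sum_const, nsmul_eq_mul, Finset.card_univ]
      exact hsum.trans (mul_le_mul_of_nonneg_left hspec hc.le)
    -- The degree sum equals `n` times `δ`, so every termwise bound is tight.
    have heq := (Finset.sum_eq_sum_iff_of_le (f := fun _ : V => G.minDegree)
      (g := fun v => G.degree v) fun v (_ : v ∈ Finset.univ) => hmin v).1
      (le_antisymm (Finset.sum_le_sum fun v _ => hmin v) (by exact_mod_cast hle'))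
    exact fun v => (heq v (Finset.mem_univ v)).symm.trans hmink
  have hadjI : ∀ a ∈ I, ∀ b, G.Adj a b ↔ b ∉ I := fun a ha b => by
    rw [← SimpleGraph.mem_neighborFinset, hfull a ha, Finset.mem_compl]
  have hfull' : ∀ b ∉ I, G.neighborFinset b = I := fun b hb =>
    (Finset.eq_of_subset_of_card_le
      (fun a ha => (G.mem_neighborFinset _ _).2 ((hadjI a ha b).2 hb).symm)
      (by rw [SimpleGraph.card_neighborFinset_eq_degree, hreg, hIk])).symm
  refine hiso (SimpleGraph.nonempty_iso_completeBipartiteGraph hIk hIc fun a b => ?_)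
  by_cases ha : a ∈ I
  · simp [hadjI a ha, ha]
  · rw [← SimpleGraph.mem_neighborFinset, hfull' a ha]
    simp [ha]
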